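/- Let $m,n\ge 1$, $V=[m]\times[n]$, and let $\mathbf C\in\mathbb R_{\ge 0}^{m\times n}$ be a cost matrix, $\boldsymbol\mu\in\Delta_m$ and $\boldsymbol\nu\in\Delta_n$ probability vectors, $\mathbf G_1\in\mathbb R^{m\times m}$ and $\mathbf G_2\in\mathbb R^{n\times n}$ positive semidefinite matrices (the Gram matrices of a kernel on the source and on the target points), and $\lambda_1,\lambda_2\ge 0$. For $\boldsymbol\gamma\in\mathbb R^{m\times n}$ put $$\mathcal U(\boldsymbol\gamma)=\langle \mathbf C,\boldsymbol\gamma\rangle+\lambda_1\|\boldsymbol\gamma\mathbf 1-\boldsymbol\mu\|_{\mathbf G_1}^2+\lambda_1\|\boldsymbol\gamma^\top\mathbf 1-\boldsymbol\nu\|_{\mathbf G_2}^2+\tfrac{\lambda_2}{2}\|\boldsymbol\gamma\|^2,\qquad \|\mathbf z\|_{\mathbf G}=\sqrt{\mathbf z^\top\mathbf G\mathbf z},$$ and for $S\subseteq V$ let $F(S)=\mathcal U(\mathbf 0)-\min\{\mathcal U(\boldsymbol\gamma):\boldsymbol\gamma\ge \mathbf 0,\ \operatorname{supp}\boldsymbol\gamma\subseteq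 S\}$; a minimizer is denoted $\boldsymbol\gamma_S$. Let $0\le K_2\le m$, $K=nK_2$, and let $\mathcal M_2$ be the partition matroid on $V$ whose independent sets are the $S\subseteq V$ with at most $K_2$ elements in each column $\{(i,j):i\in[m]\}$, $j\in[n]$. The problem ColSparseUOT is to maximize $F(S)$ over the independent sets $S$ of $\mathcal M_2$; let $S^*$ be an optimal solution. Algorithm 2 (OMP greedy algorithm under a matroid constraint) starts with $S_0=\emptyset$. In iteration $i=1,\dots,K$ it takes a base $M_i$ of the contraction $\mathcal M_2/S_{i-1}$ that maximizes $\sum_{v\in M_i}\max\bigl(0,-\nabla_v\,\mathcal U(\boldsymbol\gamma_{S_{i-1}})\bigr)$ among all bases of $\mathcal M_2/S_{i-1}$ (ties may be broken in any way that depends on the previous picks), draws an element $v_i$ of $M_i$ uniformly at random, and sets $S_i=S_{i-1}\cup\{v_i\}$. It returns $S_K$ and $\boldsymbol\gamma_{S_K}$. Let $u_{2K}>0$ and $\tilde U_1$ be such that the function $l=-\mathcal U$ satisfies $$\tfrac{u_{2K}}{2}\|\mathbf y-\mathbf x\|^2\le l(\mathbf x)-l(\mathbf y)+\langle\nabla l(\mathbf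 x),\mathbf y-\mathbf x\rangle$$ for all entrywise nonnegative $\mathbf x,\mathbf y\in\mathbb R^{m\times n}$ with at most $2K$ nonzero entries each (restricted strong concavity), and $$l(\mathbf x)-l(\mathbf y)+\langle\nabla l(\mathbf x),\mathbf y-\mathbf x\rangle\le\tfrac{\tilde U_1}{2}\|\mathbf y-\mathbf x\|^2$$ for all $\mathbf x,\mathbf y\in\mathbb R^{m\times n}$ that differ in at most one entry (restricted smoothness). Then $$\mathbb E[F(S_K)]\ \ge\ F(S^*)\,\bigl(1+\tilde U_1/u_{2K}\bigr)^{-2}.$$ -/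

import Mathlib

open scoped Matroid

noncomputable section

namespace SparseUOT

/-! ### Restricted strong concavity and restricted smoothness -/

section Restricted

variable {V : Type*} [Fintype V] [DecidableEq V]

/-- The partial derivative of `l` at `x` in the coordinate `v`. -/
def partialDeriv (l : (V → ℝ) → ℝ) (x : V → ℝ) (v : V) : ℝ :=
  lineDeriv ℝ l x (Pi.single v 1)

/-- `l(x) - l(y) + ⟨∇ l(x), y - x⟩`. -/
def linearizationGap (l : (V → ℝ) → ℝ) (x y : V → ℝ) : ℝ :=
  l x - l y + ∑ v, partialDeriv l x v * (y v - x v)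

/-- `c` is a restricted strong concavity parameter of `l` on the set of pairs `D`. -/
def HasRSC (l : (V → ℝ) → ℝ) (D : Set ((V → ℝ) × (V → ℝ))) (c : ℝ) : Prop :=
  ∀ x y, (x, y) ∈ D → c / 2 * ∑ v, (y v - x v) ^ 2 ≤ linearizationGap l x y

/-- `c` is a restricted smoothness parameter of `l` on the set of pairs `D`. -/
def HasRSM (l : (V → ℝ) → ℝ) (D : Set ((V → ℝ) × (V → ℝ))) (c : ℝ) : Prop :=
  ∀ x y, (x, y) ∈ D → linearizationGap l x y ≤ c / 2 * ∑ v, (y v - x v) ^ 2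

/-- Pairs of nonnegative vectors with at most `k` nonzero entries each. -/
def sparsePairs (V : Type*) [Fintype V] (k : ℕ) : Set ((V → ℝ) × (V → ℝ)) :=
  {p | (∀ v, 0 ≤ p.1 v) ∧ hammingNorm p.1 ≤ k ∧ (∀ v, 0 ≤ p.2 v) ∧ hammingNorm p.2 ≤ k}

/-- Pairs of vectors that differ in at most one entry. -/
def oneEntryPairs (V : Type*) [Fintype V] : Set ((V → ℝ) × (V → ℝ)) :=
  {p | hammingNorm (p.1 - p.2) ≤ 1}

end Restricted

/-! ### MMD-regularized unbalanced optimal transport -/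

/-- The data of an MMD-UOT problem with `m` source points and `n` target points. -/
structure Problem (m n : ℕ) where
  /-- cost matrix -/
  C : Matrix (Fin m) (Fin n) ℝ
  /-- source masses -/
  μ : Fin m → ℝ
  /-- target masses -/
  ν : Fin n → ℝ
  /-- Gram matrix of the kernel on the source points -/
  G₁ : Matrix (Fin m) (Fin m) ℝ
  /-- Gram matrix of the kernel on the target points -/
  G₂ : Matrix (Fin n) (Fin n) ℝ
  /-- weight of the two MMD terms -/
  lam₁ : ℝ
  /-- weight of the squared Euclidean norm -/
  lam₂ : ℝ

/-- A (candidate) transport plan: an `m × n` array of reals, indexed by the pairs `(i, j)`. -/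
abbrev Plan (m n : ℕ) : Type := Fin m × Fin n → ℝ

/-- `‖z‖_G = √(zᵀ G z)`. -/
def gramNorm {d : ℕ} (G : Matrix (Fin d) (Fin d) ℝ) (z : Fin d → ℝ) : ℝ :=
  √(z ⬝ᵥ G.mulVec z)

namespace Problem

variable {m n : ℕ} (P : Problem m n)

/-- The conditions on the data: nonnegative costs, source and target masses that form probability
vectors, positive semidefinite (Gram) matrices and nonnegative weights. -/
structure IsValid : Prop where
  cost_nonneg : ∀ i j, 0 ≤ P.C i j
  source_mem : P.μ ∈ stdSimplex ℝ (Fin m)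
  target_mem : P.ν ∈ stdSimplex ℝ (Fin n)
  gram_source : P.G₁.PosSemidef
  gram_target : P.G₂.PosSemidef
  lam₁_nonneg : 0 ≤ P.lam₁
  lam₂_nonneg : 0 ≤ P.lam₂

/-- The MMD-UOT objective
`⟨C, γ⟩ + λ₁ ‖γ 1 - μ‖²_{G₁} + λ₁ ‖γᵀ 1 - ν‖²_{G₂} + (λ₂ / 2) ‖γ‖²`. -/
def objective (γ : Plan m n) : ℝ :=
  (∑ v, P.C v.1 v.2 * γ v)
    + P.lam₁ * gramNorm P.G₁ (fun i => (∑ j, γ (i, j)) - P.μ i) ^ 2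
    + P.lam₁ * gramNorm P.G₂ (fun j => (∑ i, γ (i, j)) - P.ν j) ^ 2
    + P.lam₂ / 2 * ∑ v, γ v ^ 2

/-- Nonnegative plans whose support is contained in `S`. -/
def feasible (S : Finset (Fin m × Fin n)) : Set (Plan m n) :=
  {γ | (∀ v, 0 ≤ γ v) ∧ ∀ v, v ∉ S → γ v = 0}

/-- `γ` is a minimizer of the objective among the nonnegative plans supported in `S`. -/
def IsOptimalPlan (S : Finset (Fin m × Fin n)) (γ : Plan m n) : Prop :=
  γ ∈ feasible S ∧ ∀ γ' ∈ feasible S, P.objective γ ≤ P.objective γ'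

/-- The set function
`F(S) = U(0) - min {U(γ) : γ ≥ 0, supp γ ⊆ S}`, for the objective `U`. -/
def F (S : Finset (Fin m × Fin n)) : ℝ :=
  P.objective 0 - sInf (P.objective '' feasible S)

end Problem

/-! ### The partition matroid -/

/-- The partition matroid on the index set of an `m × n` matrix: a set of entries is independent
if it has at most `K₂` elements in each column. -/
def partitionMatroid (m n K₂ : ℕ) : Matroid (Fin m × Fin n) :=
  (IndepMatroid.ofFinset Set.univ
    (fun S => ∀ j, (S.filter (fun v => v.2 = j)).card ≤ K₂)
    (by simp)
    (fun I J hJ hIJ j => (Finset.card_le_card (Finset.filter_subset_filter _ hIJ)).trans (hJ j))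
    (by
      intro I J hI hJ hlt
      have hex : ∃ j, (I.filter (fun v => v.2 = j)).card < (J.filter (fun v => v.2 = j)).card := by
        by_contra! hcon
        have h1 := Finset.card_eq_sum_card_fiberwise (s := I) (t := Finset.univ)
          (f := fun v => v.2) (fun _ _ => Finset.mem_coe.2 (Finset.mem_univ _))
        have h2 := Finset.card_eq_sum_card_fiberwise (s := J) (t := Finset.univ)
          (f := fun v => v.2) (fun _ _ => Finset.mem_coe.2 (Finset.mem_univ _))
        have h3 := Finset.sum_le_sum (s := Finset.univ) (fun j _ => hcon j)
        omega
      obtain ⟨j, hj⟩ := hex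
      obtain ⟨e, heJ, heI⟩ := Finset.exists_mem_notMem_of_card_lt_card hj
      have he := Finset.mem_filter.1 heJ
      refine ⟨e, he.1, fun h => heI (Finset.mem_filter.2 ⟨h, he.2⟩), fun j' => ?_⟩
      rw [Finset.filter_insert]
      split_ifs with h
      · have hjj : j = j' := he.2.symm.trans h
        subst hjj
        exact (Finset.card_insert_le _ _).trans ((Nat.succ_le_of_lt hj).trans (hJ j))
      · exact hI j')
    (fun _ _ => Set.subset_univ _)).matroid

theorem partitionMatroid_indep_iff {m n K₂ : ℕ} (S : Finset (Fin m × Fin n)) :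
    (partitionMatroid m n K₂).Indep ↑S ↔ ∀ j, (S.filter (fun v => v.2 = j)).card ≤ K₂ := by
  simp [partitionMatroid, IndepMatroid.ofFinset_indep]

/-! ### The OMP greedy algorithm under a matroid constraint -/

section Algorithm

variable {V : Type*} [DecidableEq V]

/-- `B` is a base of the contraction `M ／ S` that maximizes the sum of the positive parts
of the weights `g`. -/
def IsGreedyBase (M : Matroid V) (g : V → ℝ) (S B : Finset V) : Prop :=
  (M ／ (S : Set V)).IsBase (B : Set V) ∧
    ∀ B' : Finset V, (M ／ (S : Set V)).IsBase (B' : Set V) →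
      ∑ v ∈ B', max 0 (g v) ≤ ∑ v ∈ B, max 0 (g v)

/-- The law of the list of the first `k` picks, the most recent one first. In each iteration the
next pick is uniform in the set `base l`, where `l` is the list of the previous picks. (If that set
is empty, there is nothing to pick and the list stays as it is.) -/
def pickLaw (base : List V → Finset V) : ℕ → PMF (List V)
  | 0 => PMF.pure []
  | k + 1 => (pickLaw base k).bind fun l =>
      if h : (base l).Nonempty then (PMF.uniformOfFinset (base l) h).map (fun v => v :: l)
      else PMF.pure l

/-- The law of the set `S_k` of the first `k` picks. -/
def outputLaw (base : List V → Finset V) (k : ℕ) : PMF (Finset V) :=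
  (pickLaw base k).map List.toFinset

/-- The expectation of `f` under a law on a finite type. -/
def expect {A : Type*} [Fintype A] (p : PMF A) (f : A → ℝ) : ℝ :=
  ∑ a, (p a).toReal * f a

end Algorithm

/-- `γ` and `base` are admissible choices in the OMP greedy algorithm for the objective of `P`
under the matroid constraint `M`: `γ S` is an optimal plan supported in `S`, and after the picks in
the list `l`, with `S` the set of these picks, `base l` is a base of `M ／ S` of maximum total
positive part of `-∇ U (γ S)`. Ties may be broken depending on all previous picks. -/
structure IsOMPGreedy {m n : ℕ} (P : Problem m n) (M : Matroid (Fin m × Fin n))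
    (γ : Finset (Fin m × Fin n) → Plan m n)
    (base : List (Fin m × Fin n) → Finset (Fin m × Fin n)) : Prop where
  isOptimalPlan : ∀ S : Finset (Fin m × Fin n), M.Indep ↑S → P.IsOptimalPlan S (γ S)
  isGreedyBase : ∀ l : List (Fin m × Fin n), l.Nodup → M.Indep ↑l.toFinset →
    IsGreedyBase M (fun v => -partialDeriv P.objective (γ l.toFinset) v) l.toFinset (base l)

end SparseUOT

end

namespace SparseUOT

open Finset

/-! ### Averages of a set function over the subsets of a given size -/

section SubsetAverage

variable {V : Type*}

/-! Put a = u / U and K = n K₂. Restricted smoothness bounds the gain of one new entry below by g² /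
(2U), where g is the positive part of the partial derivative. Restricted strong concavity bounds the
gain of a whole set T above by the sum of g² / (2u) over T. So inside an independent set, the single
gains add up to at least a times the joint gain (`IsOMPGreedy.weak_submodular`). Moreover, a greedy
base of the contraction dominates any other base O under a column-preserving bijection e, so its
single gains at S add up to at least a (F(O) - F(S)) (`IsOMPGreedy.sum_gain_ge`).

Let A_j(O) be the average of F over the j-subsets of O. When v is picked, O is replaced by O minus
e(v). Since v is uniform, the deleted element is uniform in O, and for j < #O the mean of A_j over
these deletions is again A_j(O). Only the top term A_k(O) = F(O), k = #O, is lost, and the gain of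
the pick pays for it. Induction on the number of remaining picks
(`IsOMPGreedy.expect_completionLaw_ge`), started from ∅ and a base B that contains the given
independent set, yields a · mean(A_1(B), ..., A_K(B)) ≤ (1 + a) E[F(S_K)].

Weak submodularity inside B forces the sequence A_j(B) to grow, and summation by parts gives a F(B)
≤ (1 + a) · mean(A_1(B), ..., A_K(B)). Each of the two inequalities costs one factor a / (1 + a) =
(1 + U / u)⁻¹, hence the square. -/

/-- The average of `f` over the `j`-element subsets of `O`. -/
noncomputable def subsetAverage (f : Finset V → ℝ) (j : ℕ) (O : Finset V) : ℝ :=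
  (∑ R ∈ O.powersetCard j, f R) / (#O).choose j

theorem subsetAverage_card (f : Finset V → ℝ) (O : Finset V) :
    subsetAverage f #O O = f O := by
  simp [subsetAverage, powersetCard_self]

theorem subsetAverage_zero (f : Finset V → ℝ) (O : Finset V) :
    subsetAverage f 0 O = f ∅ := by
  simp [subsetAverage]

/-- Double counting: a j-subset R of O survives the deletion of v exactly when v lies in O \ R. -/
theorem sum_sum_powersetCard_erase [DecidableEq V] (f : Finset V → ℝ) (j : ℕ) (O : Finset V) :
    ∑ v ∈ O, ∑ R ∈ (O.erase v).powersetCard j, f R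
      = (#O - j : ℝ) * ∑ R ∈ O.powersetCard j, f R := by
  rw [sum_comm' (t' := O.powersetCard j) (s' := fun R => O \ R), mul_sum]
  · refine sum_congr rfl fun R hR => ?_
    obtain ⟨hRO, hc⟩ := mem_powersetCard.1 hR
    rw [sum_const, nsmul_eq_mul, cast_card_sdiff hRO, hc]
  · intro v R
    simp only [mem_powersetCard, mem_sdiff, subset_erase]
    tauto

/-- Double counting: each (j + 1)-subset arises once for each of its elements as the one inserted
last. -/
theorem sum_sum_powersetCard_insert [DecidableEq V] (f : Finset V → ℝ) (j : ℕ) (O : Finset V) :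
    ∑ R ∈ O.powersetCard j, ∑ v ∈ O \ R, f (insert v R)
      = (j + 1 : ℝ) * ∑ R ∈ O.powersetCard (j + 1), f R := by
  have h : ∑ R ∈ O.powersetCard (j + 1), ∑ _v ∈ R, f R
      = (j + 1 : ℝ) * ∑ R ∈ O.powersetCard (j + 1), f R := by
    rw [mul_sum]
    refine sum_congr rfl fun R hR => ?_
    rw [sum_const, nsmul_eq_mul, (mem_powersetCard.1 hR).2]
    push_cast
    rfl
  rw [← h, sum_sigma', sum_sigma']
  refine sum_bij' (fun p _ => ⟨insert p.2 p.1, p.2⟩) (fun p _ => ⟨p.1.erase p.2, p.2⟩)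
    ?_ ?_ ?_ ?_ ?_
  · rintro ⟨R, v⟩ hp
    simp only [mem_sigma, mem_powersetCard, mem_sdiff] at hp ⊢
    obtain ⟨⟨hR, hc⟩, hv, hvR⟩ := hp
    exact ⟨⟨insert_subset hv hR, by rw [card_insert_of_notMem hvR, hc]⟩, mem_insert_self _ _⟩
  · rintro ⟨R, v⟩ hp
    simp only [mem_sigma, mem_powersetCard, mem_sdiff] at hp ⊢
    obtain ⟨⟨hR, hc⟩, hv⟩ := hp
    exact ⟨⟨(erase_subset _ _).trans hR, by rw [card_erase_of_mem hv, hc]; rfl⟩, hR hv,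
      notMem_erase _ _⟩
  · rintro ⟨R, v⟩ hp
    simp only [mem_sigma, mem_sdiff] at hp
    simp [erase_insert hp.2.2]
  · rintro ⟨R, v⟩ hp
    simp only [mem_sigma] at hp
    simp [insert_erase hp.2]
  · intros; rfl

/-- A uniform j-subset of O with a uniform element deleted is a uniform j-subset of O. This is what
lets the comparison set shrink along the run without changing its averages. -/
theorem sum_subsetAverage_erase [DecidableEq V] (f : Finset V → ℝ) {j k : ℕ} {O : Finset V} (hO : #O = k + 1)
    (hj : j ≤ k) :
    ∑ v ∈ O, subsetAverage f j (O.erase v) = (k + 1) * subsetAverage f j O := by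
  have h1 : ∑ v ∈ O, subsetAverage f j (O.erase v)
      = (∑ v ∈ O, ∑ R ∈ (O.erase v).powersetCard j, f R) / k.choose j := by
    rw [sum_div]
    refine sum_congr rfl fun v hv => ?_
    rw [subsetAverage, card_erase_of_mem hv, hO, Nat.add_sub_cancel]
  have h2 : ((k + 1).choose j : ℝ) * (k + 1 - j) = k.choose j * (k + 1) := by
    have h := Nat.choose_mul_succ_eq k j
    have h' : ((k + 1 - j : ℕ) : ℝ) = k + 1 - j := by
      rw [Nat.cast_sub (by omega)]; push_cast; ring
    rw [← h']
    exact_mod_cast h.symm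
  have h3 : (0 : ℝ) < k.choose j := by exact_mod_cast Nat.choose_pos hj
  have h4 : (0 : ℝ) < (k + 1).choose j := by exact_mod_cast Nat.choose_pos (by omega)
  rw [h1, sum_sum_powersetCard_erase, subsetAverage, hO]
  push_cast
  field_simp
  linear_combination (∑ R ∈ O.powersetCard j, f R) * h2

/-- If the marginal gains of the elements of `O \ R` add up to at least `a` times the joint gain,
then the averages over the subsets of `O` grow accordingly. -/
theorem subsetAverage_succ_sub_ge [DecidableEq V] (f : Finset V → ℝ) {a : ℝ} {j : ℕ} {O : Finset V}
    (hj : j < #O)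
    (hf : ∀ R ⊆ O, a * (f O - f R) ≤ ∑ v ∈ O \ R, (f (insert v R) - f R)) :
    a * (f O - subsetAverage f j O)
      ≤ (#O - j) * (subsetAverage f (j + 1) O - subsetAverage f j O) := by
  have h1 : ∑ R ∈ O.powersetCard j, a * (f O - f R)
      ≤ ∑ R ∈ O.powersetCard j, ∑ v ∈ O \ R, (f (insert v R) - f R) :=
    sum_le_sum fun R hR => hf R (mem_powersetCard.1 hR).1
  have h2 : ∑ R ∈ O.powersetCard j, ∑ v ∈ O \ R, (f (insert v R) - f R)
      = (j + 1 : ℝ) * ∑ R ∈ O.powersetCard (j + 1), f R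
        - (#O - j : ℝ) * ∑ R ∈ O.powersetCard j, f R := by
    rw [← sum_sum_powersetCard_insert, mul_sum, ← sum_sub_distrib]
    refine sum_congr rfl fun R hR => ?_
    obtain ⟨hRO, hc⟩ := mem_powersetCard.1 hR
    rw [sum_sub_distrib, sum_const, nsmul_eq_mul, cast_card_sdiff hRO, hc]
  have h3 : ∑ R ∈ O.powersetCard j, a * (f O - f R)
      = a * ((#O).choose j * f O - ∑ R ∈ O.powersetCard j, f R) := by
    rw [← mul_sum, sum_sub_distrib, sum_const, card_powersetCard, nsmul_eq_mul]
  rw [h2, h3] at h1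
  have h4 : ((#O).choose (j + 1) : ℝ) * (j + 1) = (#O).choose j * (#O - j) := by
    have h := Nat.choose_succ_right_eq (#O) j
    rw [← Nat.cast_sub hj.le]
    exact_mod_cast h
  have h5 : (0 : ℝ) < (#O).choose j := by exact_mod_cast Nat.choose_pos hj.le
  have h6 : (0 : ℝ) < (#O).choose (j + 1) := by exact_mod_cast Nat.choose_pos hj
  have e1 : ∑ R ∈ O.powersetCard j, f R = (#O).choose j * subsetAverage f j O := by
    rw [subsetAverage]; field_simp
  have e2 : ∑ R ∈ O.powersetCard (j + 1), f R
      = (#O).choose (j + 1) * subsetAverage f (j + 1) O := by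
    rw [subsetAverage]; field_simp
  rw [e1, e2] at h1
  refine le_of_mul_le_mul_left ?_ h5
  linear_combination h1 + subsetAverage f (j + 1) O * h4

end SubsetAverage

/-- A discrete analogue of `∫ x ^ a = 1 / (1 + a)`: a monotone sequence from `0` to `A K` whose
increments are at least a fixed fraction of the average remaining increment is large on average. -/
theorem sum_range_ge_of_increments {A : ℕ → ℝ} {K : ℕ} {a : ℝ} (ha : 0 ≤ a) (h0 : A 0 = 0)
    (hK : 0 ≤ A K)
    (hA : ∀ j < K, a * (A K - A j) ≤ (K - j) * (A (j + 1) - A j)) :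
    K * (a * A K) ≤ (1 + a) * ∑ j ∈ range K, A (j + 1) := by
  have h1 : ∑ j ∈ range K, a * (A K - A j) ≤ ∑ j ∈ range K, (K - j) * (A (j + 1) - A j) :=
    sum_le_sum fun j hj => hA j (mem_range.1 hj)
  -- Summation by parts; at N = K the boundary term at the upper end vanishes.
  have h2 : ∀ N : ℕ, ∑ j ∈ range N, ((K : ℝ) - j) * (A (j + 1) - A j)
      = (K - N) * A N - K * A 0 + ∑ j ∈ range N, A (j + 1) := by
    intro N
    induction N with
    | zero => simp
    | succ N ih =>
      rw [sum_range_succ, ih, sum_range_succ]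
      push_cast
      ring
  have h3 : ∑ j ∈ range K, A j = ∑ j ∈ range K, A (j + 1) - A K := by
    have := sum_range_succ A K
    have := sum_range_succ' A K
    linarith
  rw [h2, ← mul_sum, sum_sub_distrib, sum_const, card_range, nsmul_eq_mul, h0, h3] at h1
  nlinarith [mul_nonneg ha hK]

/-! ### Column-preserving bijections -/

theorem exists_bijOn_of_card_fiber_eq {V J : Type*} [DecidableEq J]
    (c : V → J) (A B : Finset V) (h : ∀ j, #{v ∈ A | c v = j} = #{v ∈ B | c v = j}) :
    ∃ g : V → V, Set.BijOn g A B ∧ ∀ v ∈ A, c (g v) = c v := by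
  have hj : ∀ j, ∃ g : V → V,
      Set.BijOn g ↑{v ∈ A | c v = j} ↑{v ∈ B | c v = j} := fun j => by
    rcases isEmpty_or_nonempty V with hV | hV
    · exact ⟨id, by
        have : (A.filter (fun v => c v = j)) = (B.filter (fun v => c v = j)) :=
          Finset.ext fun v => hV.elim v
        rw [this]; exact Set.bijOn_id _⟩
    · obtain ⟨g, hg⟩ := (Finset.finite_toSet {v ∈ A | c v = j}).exists_bijOn_of_encard_eq
        (t := (({v ∈ B | c v = j} : Finset V) : Set V)) (by simp only [Set.encard_coe_eq_coe_finsetCard, h])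
      exact ⟨g, hg⟩
  choose g hg using hj
  have hmap : ∀ v ∈ A, g (c v) v ∈ B ∧ c (g (c v) v) = c v := fun v hv => by
    simpa using (hg (c v)).mapsTo (show v ∈ (↑{w ∈ A | c w = c v} : Set V) by simpa using hv)
  refine ⟨fun v => g (c v) v, ⟨fun v hv => (hmap v hv).1, ?_, ?_⟩, fun v hv => (hmap v hv).2⟩
  · intro v hv w hw hvw
    have hc : c v = c w := by
      rw [← (hmap v hv).2, ← (hmap w hw).2]; exact congrArg c hvw
    refine (hg (c v)).injOn (by simpa using hv) (by simpa [hc] using hw) ?_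
    simpa [hc] using hvw
  · intro b hb
    obtain ⟨v, hv, hvb⟩ := (hg (c b)).surjOn (show b ∈ (↑{w ∈ B | c w = c b} : Set V) by
      simpa using hb)
    simp only [coe_filter, Set.mem_ofPred_eq] at hv
    exact ⟨v, hv.1, by simpa [hv.2] using hvb⟩

/-- Finite sets with fibers of the same sizes are in a fiber-preserving bijection that fixes the
common elements. -/
theorem exists_bijOn_fix_inter {V J : Type*} [DecidableEq V] [DecidableEq J]
    (c : V → J) (A B : Finset V) (h : ∀ j, #{v ∈ A | c v = j} = #{v ∈ B | c v = j}) :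
    ∃ g : V → V, Set.BijOn g A B ∧ (∀ v ∈ A, c (g v) = c v) ∧ (∀ v ∈ A, v ∈ B → g v = v) ∧
      ∀ v ∈ A, v ∉ B → g v ∉ A := by
  obtain ⟨g, hg, hc⟩ := exists_bijOn_of_card_fiber_eq c (A \ B) (B \ A) fun j => by
    have e1 := card_sdiff_add_card_inter {v ∈ A | c v = j} {v ∈ B | c v = j}
    have e2 := card_sdiff_add_card_inter {v ∈ B | c v = j} {v ∈ A | c v = j}
    have e3 : {v ∈ A | c v = j} \ {v ∈ B | c v = j} = {v ∈ A \ B | c v = j} := by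
      ext v; simp only [mem_sdiff, mem_filter]; tauto
    have e4 : {v ∈ B | c v = j} \ {v ∈ A | c v = j} = {v ∈ B \ A | c v = j} := by
      ext v; simp only [mem_sdiff, mem_filter]; tauto
    rw [e3] at e1
    rw [e4, inter_comm] at e2
    have := h j
    omega
  have hm : ∀ v ∈ A, v ∉ B → g v ∈ B ∧ g v ∉ A := fun v hv hvB => by
    simpa using hg.mapsTo (show v ∈ (↑(A \ B) : Set V) by simp [hv, hvB])
  refine ⟨fun v => if v ∈ B then v else g v, ⟨?_, ?_, ?_⟩, ?_, ?_, ?_⟩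
  · intro v hv
    by_cases hvB : v ∈ B
    · simp [hvB]
    · simpa [hvB] using (hm v hv hvB).1
  · intro v hv w hw hvw
    by_cases hvB : v ∈ B <;> by_cases hwB : w ∈ B <;> simp only [hvB, hwB, if_true, if_false] at hvw
    · exact hvw
    · exact absurd (hvw ▸ hv) (hm w hw hwB).2
    · exact absurd (hvw ▸ hw) (hm v hv hvB).2
    · exact hg.injOn (by simpa using ⟨hv, hvB⟩) (by simpa using ⟨hw, hwB⟩) hvw
  · intro b hb
    by_cases hbA : b ∈ A
    · exact ⟨b, hbA, by simp only [mem_coe] at hb; simp [hb]⟩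
    · obtain ⟨v, hv, rfl⟩ := hg.surjOn (show b ∈ (↑(B \ A) : Set V) by simpa using ⟨hb, hbA⟩)
      simp only [coe_sdiff, Set.mem_sdiff, mem_coe] at hv
      exact ⟨v, hv.1, by simp [hv.2]⟩
  · intro v hv
    by_cases hvB : v ∈ B
    · simp [hvB]
    · simpa [hvB] using hc v (by simp [hv, hvB])
  · intro v _ hvB
    simp [hvB]
  · intro v hv hvB
    simpa [hvB] using (hm v hv hvB).2

/-! ### Consequences of restricted smoothness and restricted strong concavity -/

theorem partialDeriv_neg {V : Type*} [DecidableEq V] (l : (V → ℝ) → ℝ) (x : V → ℝ) (v : V) :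
    partialDeriv (fun y => -l y) x v = -partialDeriv l x v := by
  simp only [partialDeriv, lineDeriv]
  exact deriv.fun_neg

section Restricted

variable {V : Type*} [Fintype V] [DecidableEq V] {l : (V → ℝ) → ℝ} {u U : ℝ}

theorem HasRSM.le_apply_add_single (hM : HasRSM l (oneEntryPairs V) U) (x : V → ℝ) (v : V)
    (t : ℝ) : l x + t * partialDeriv l x v - U / 2 * t ^ 2 ≤ l (x + Pi.single v t) := by
  have h := hM x (x + Pi.single v t) (by
    simp only [oneEntryPairs, Set.mem_ofPred_eq, hammingNorm]
    refine (card_le_card (t := {v}) fun w hw => ?_).trans (card_singleton v).le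
    by_contra hwv
    rw [mem_singleton] at hwv
    simp [Pi.single_eq_of_ne hwv] at hw)
  have e1 : ∑ w, partialDeriv l x w * ((x + Pi.single v t : V → ℝ) w - x w) = partialDeriv l x v * t := by
    rw [sum_eq_single v (fun w _ hw => by simp [hw]) (by simp)]
    simp
  have e2 : ∑ w, ((x + Pi.single v t : V → ℝ) w - x w) ^ 2 = t ^ 2 := by
    rw [sum_eq_single v (fun w _ hw => by simp [hw]) (by simp)]
    simp
  rw [linearizationGap, e1, e2] at h
  linarith

/-- Both conditions apply to the pair of 0 and a unit vector. This is the source of U > 0, which is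
not assumed of a smoothness parameter. -/
theorem HasRSC.le_smoothness {k : ℕ} (hk : 1 ≤ k) (hC : HasRSC l (sparsePairs V k) u)
    (hM : HasRSM l (oneEntryPairs V) U) (v : V) : u ≤ U := by
  have hs : hammingNorm (Pi.single v (1 : ℝ) : V → ℝ) ≤ 1 := by
    refine (card_le_card (t := {v}) fun w hw => ?_).trans (card_singleton v).le
    by_contra hwv
    rw [mem_singleton] at hwv
    simp [Pi.single_eq_of_ne hwv] at hw
  have h1 := hC 0 (Pi.single v 1) ⟨by simp, by simp, fun w => by
    by_cases h : w = v
    · subst h; simp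
    · simp [h], hs.trans hk⟩
  have h2 := hM 0 (Pi.single v 1) (by
    simpa only [oneEntryPairs, Set.mem_ofPred_eq, zero_sub, hammingNorm, Pi.neg_apply, ne_eq,
      neg_eq_zero] using hs)
  have e : ∑ w, ((Pi.single v 1 : V → ℝ) w - (0 : V → ℝ) w) ^ 2 = 1 := by
    rw [sum_eq_single v (fun w _ hw => by simp [hw]) (by simp)]
    simp
  have h3 := h1.trans h2
  rw [e] at h3
  linarith

/-- The first-order optimality condition for a maximizer over the nonnegative vectors supported
in `S`. -/
theorem HasRSM.partialDeriv_mul_sub_nonpos (hU : 0 < U) (hM : HasRSM l (oneEntryPairs V) U)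
    {S : Finset V} {x : V → ℝ} (hx : ∀ v, 0 ≤ x v) (hxS : ∀ v, v ∉ S → x v = 0)
    (hmax : ∀ y : V → ℝ, (∀ v, 0 ≤ y v) → (∀ v, v ∉ S → y v = 0) → l y ≤ l x)
    {v : V} (hv : v ∈ S) {s : ℝ} (hs : 0 ≤ s) : partialDeriv l x v * (s - x v) ≤ 0 := by
  by_contra! hpos
  set d := s - x v with hd
  set g := partialDeriv l x v
  have hd0 : 0 < U * d ^ 2 := by
    have : d ≠ 0 := by rintro h; simp [h] at hpos
    positivity
  -- A step of length θ towards s stays nonnegative since θ ≤ 1, and the second bound keeps the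
  -- quadratic loss at most half of the linear gain.
  set θ := min 1 (g * d / (U * d ^ 2)) with hθ
  have hθ0 : 0 < θ := lt_min one_pos (div_pos hpos hd0)
  have hθ1 : θ ≤ 1 := min_le_left _ _
  have hθ2 : θ * (U * d ^ 2) ≤ g * d := (le_div_iff₀ hd0).1 (min_le_right _ _)
  have h1 := hM.le_apply_add_single x v (θ * d)
  have h2 := hmax (x + Pi.single v (θ * d)) (fun w => by
      by_cases hw : w = v
      · subst hw
        simp only [Pi.add_apply, Pi.single_eq_same]
        have := hx w
        nlinarith [mul_nonneg hθ0.le hs, mul_nonneg (sub_nonneg.2 hθ1) (hx w)]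
      · simpa [hw] using hx w)
    (fun w hw => by
      have : w ≠ v := fun h => hw (h ▸ hv)
      simp [this, hxS w hw])
  have h3 : θ * (θ * (U * d ^ 2)) ≤ θ * (g * d) := mul_le_mul_of_nonneg_left hθ2 hθ0.le
  have h4 : 0 < θ * (g * d) := mul_pos hθ0 hpos
  nlinarith

/-- Adding one entry to the support increases the maximum by at least the gain of a gradient
step. -/
theorem HasRSM.sq_partialDeriv_le_gain (hU : 0 < U) (hM : HasRSM l (oneEntryPairs V) U)
    {S : Finset V} {x z : V → ℝ} (hx : ∀ v, 0 ≤ x v) (hxS : ∀ v, v ∉ S → x v = 0) {v : V}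
    (hz : ∀ y : V → ℝ, (∀ w, 0 ≤ y w) → (∀ w, w ∉ insert v S → y w = 0) → l y ≤ l z) :
    max 0 (partialDeriv l x v) ^ 2 / (2 * U) ≤ l z - l x := by
  set g := max 0 (partialDeriv l x v) with hg
  have hg0 : 0 ≤ g := le_max_left _ _
  -- The step g / U maximizes the quadratic lower bound g t - U t² / 2.
  have h1 := hM.le_apply_add_single x v (g / U)
  have h2 := hz (x + Pi.single v (g / U)) (fun w => by
      by_cases hw : w = v
      · subst hw
        simpa using add_nonneg (hx w) (div_nonneg hg0 hU.le)
      · simpa [hw] using hx w)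
    (fun w hw => by
      have : w ≠ v := fun h => hw (h ▸ mem_insert_self _ _)
      simp [this, hxS w fun h => hw (mem_insert_of_mem h)])
  have h3 : g * partialDeriv l x v = g * g := by
    rcases le_total (partialDeriv l x v) 0 with h | h
    · rw [hg, max_eq_left h]; ring
    · rw [hg, max_eq_right h]
  have h4 : g / U * partialDeriv l x v - U / 2 * (g / U) ^ 2 = g ^ 2 / (2 * U) := by
    rw [div_mul_eq_mul_div, h3]
    field_simp
    ring
  linarith

/-- The gain of adding a set `T` to the support is at most a sum of squared partial derivatives
over `T`. -/
theorem HasRSC.gain_le_sum_sq (hu : 0 < u) (hU : 0 < U) (hM : HasRSM l (oneEntryPairs V) U)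
    {k : ℕ} (hC : HasRSC l (sparsePairs V k) u) {S T : Finset V} (hST : Disjoint T S)
    (hk : #(S ∪ T) ≤ k) {x z : V → ℝ} (hx : ∀ v, 0 ≤ x v) (hxS : ∀ v, v ∉ S → x v = 0)
    (hmax : ∀ y : V → ℝ, (∀ v, 0 ≤ y v) → (∀ v, v ∉ S → y v = 0) → l y ≤ l x)
    (hz : ∀ v, 0 ≤ z v) (hzS : ∀ v, v ∉ S ∪ T → z v = 0) :
    l z - l x ≤ ∑ v ∈ T, max 0 (partialDeriv l x v) ^ 2 / (2 * u) := by
  have hxk : hammingNorm x ≤ k := (card_le_card fun v hv => by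
    by_contra h
    exact (mem_filter.1 hv).2 (hxS v fun h' => h (mem_union_left _ h'))).trans hk
  have hzk : hammingNorm z ≤ k := (card_le_card fun v hv => by
    by_contra h
    exact (mem_filter.1 hv).2 (hzS v h)).trans hk
  have h := hC x z ⟨hx, hxk, hz, hzk⟩
  rw [linearizationGap, mul_sum] at h
  -- On T, x vanishes and the concave quadratic in z v is at most its maximum. On S, first-order
  -- optimality of x makes the linear term nonpositive. Elsewhere both vectors vanish.
  have hterm : ∀ v, partialDeriv l x v * (z v - x v) - u / 2 * (z v - x v) ^ 2
      ≤ if v ∈ T then max 0 (partialDeriv l x v) ^ 2 / (2 * u) else 0 := by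
    intro v
    split_ifs with hv
    · rw [hxS v (disjoint_left.1 hST hv), sub_zero, le_div_iff₀ (by positivity)]
      have h1 : partialDeriv l x v * z v ≤ max 0 (partialDeriv l x v) * z v :=
        mul_le_mul_of_nonneg_right (le_max_right _ _) (hz v)
      nlinarith [sq_nonneg (max 0 (partialDeriv l x v) - u * z v)]
    · have h2 : 0 ≤ u / 2 * (z v - x v) ^ 2 := by positivity
      by_cases hvS : v ∈ S
      · linarith [hM.partialDeriv_mul_sub_nonpos hU hx hxS hmax hvS (hz v)]
      · rw [hxS v hvS, hzS v (by simp [hv, hvS])]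
        simp
  have hsum := sum_le_sum fun v (_ : v ∈ univ) => hterm v
  rw [sum_sub_distrib, sum_ite_mem, univ_inter] at hsum
  linarith

end Restricted

/-! ### The first-order bounds as bounds on the marginal gains of `F` -/

namespace Problem

variable {m n : ℕ} {P : Problem m n} {S T : Finset (Fin m × Fin n)} {x z : Plan m n}

theorem IsOptimalPlan.F_eq (h : P.IsOptimalPlan S x) : P.F S = P.objective 0 - P.objective x := by
  have : IsLeast (P.objective '' feasible S) (P.objective x) :=
    ⟨⟨x, h.1, rfl⟩, by rintro _ ⟨y, hy, rfl⟩; exact h.2 y hy⟩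
  rw [F, this.csInf_eq]

theorem IsOptimalPlan.F_mono (hS : P.IsOptimalPlan S x) (hT : P.IsOptimalPlan T z) (h : S ⊆ T) :
    P.F S ≤ P.F T := by
  rw [hS.F_eq, hT.F_eq]
  have := hT.2 x ⟨hS.1.1, fun v hv => hS.1.2 v fun h' => hv (h h')⟩
  linarith

theorem IsOptimalPlan.F_empty (h : P.IsOptimalPlan ∅ x) : P.F ∅ = 0 := by
  have : x = 0 := funext fun v => h.1.2 v (notMem_empty v)
  rw [h.F_eq, this, sub_self]

theorem IsOptimalPlan.F_insert_sub_ge {U : ℝ} (hU : 0 < U)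
    (hM : HasRSM (fun γ => -P.objective γ) (oneEntryPairs (Fin m × Fin n)) U)
    {v : Fin m × Fin n} (hS : P.IsOptimalPlan S x) (hT : P.IsOptimalPlan (insert v S) z) :
    max 0 (-partialDeriv P.objective x v) ^ 2 / (2 * U) ≤ P.F (insert v S) - P.F S := by
  have h := hM.sq_partialDeriv_le_gain hU hS.1.1 hS.1.2 (z := z) (v := v)
    fun y hy hyS => neg_le_neg (hT.2 y ⟨hy, hyS⟩)
  rw [partialDeriv_neg] at h
  rw [hS.F_eq, hT.F_eq]
  linarith

theorem IsOptimalPlan.F_union_sub_le {u U : ℝ} (hu : 0 < u) (hU : 0 < U)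
    (hM : HasRSM (fun γ => -P.objective γ) (oneEntryPairs (Fin m × Fin n)) U) {k : ℕ}
    (hC : HasRSC (fun γ => -P.objective γ) (sparsePairs (Fin m × Fin n) k) u)
    (hS : P.IsOptimalPlan S x) (hT : P.IsOptimalPlan (S ∪ T) z) (hST : Disjoint T S)
    (hk : #(S ∪ T) ≤ k) :
    P.F (S ∪ T) - P.F S ≤ ∑ v ∈ T, max 0 (-partialDeriv P.objective x v) ^ 2 / (2 * u) := by
  have h := hC.gain_le_sum_sq hu hU hM hST hk hS.1.1 hS.1.2
    (fun y hy hyS => neg_le_neg (hS.2 y ⟨hy, hyS⟩)) hT.1.1 hT.1.2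
  simp only [partialDeriv_neg] at h
  rw [hS.F_eq, hT.F_eq]
  linarith

end Problem

/-! ### Bases of the partition matroid -/

section Matroid

variable {m n K₂ : ℕ} {S B O : Finset (Fin m × Fin n)}

theorem partitionMatroid_isBase_iff (hK : K₂ ≤ m) :
    (partitionMatroid m n K₂).IsBase (B : Set (Fin m × Fin n)) ↔
      ∀ j, #{v ∈ B | v.2 = j} = K₂ := by
  constructor
  · intro hB j
    have hind := (partitionMatroid_indep_iff B).1 hB.indep
    by_contra hne
    have hlt : #{v ∈ B | v.2 = j} < K₂ := lt_of_le_of_ne (hind j) hne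
    -- A column has m ≥ K₂ entries, so one with fewer than K₂ chosen entries has room.
    obtain ⟨v, hvj, hvB⟩ : ∃ v : Fin m × Fin n, v.2 = j ∧ v ∉ B := by
      by_contra! hcon
      have h1 : #(univ.image fun i : Fin m => (i, j)) ≤ #{v ∈ B | v.2 = j} := by
        refine card_le_card fun v hv => ?_
        obtain ⟨i, -, rfl⟩ := mem_image.1 hv
        exact mem_filter.2 ⟨hcon _ rfl, rfl⟩
      rw [card_image_of_injective _ (fun a b h => (Prod.ext_iff.1 h).1), card_univ,
        Fintype.card_fin] at h1
      omega
    have hins : (partitionMatroid m n K₂).Indep ↑(insert v B) := by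
      rw [partitionMatroid_indep_iff]
      intro j'
      rw [filter_insert]
      split_ifs with h
      · have : j = j' := hvj.symm.trans h
        subst this
        exact (card_insert_le _ _).trans hlt
      · exact hind j'
    have h := hB.eq_of_subset_indep hins (by simp)
    exact hvB (by rw [coe_inj.1 h]; exact mem_insert_self _ _)
  · intro hB
    refine ((partitionMatroid_indep_iff B).2 fun j => (hB j).le).isBase_of_maximal
      fun J hJ hBJ => ?_
    lift J to Finset (Fin m × Fin n) using Set.toFinite J
    rw [partitionMatroid_indep_iff] at hJ
    rw [coe_subset] at hBJ
    refine congrArg _ (hBJ.antisymm fun v hv => ?_)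
    have := eq_of_subset_of_card_le (filter_subset_filter (fun w => w.2 = v.2) hBJ)
      ((hJ v.2).trans (hB v.2).ge)
    have hv' : v ∈ J.filter (fun w => w.2 = v.2) := mem_filter.2 ⟨hv, rfl⟩
    rw [← this] at hv'
    exact (mem_filter.1 hv').1

theorem card_le_of_partitionMatroid_indep
    (hB : (partitionMatroid m n K₂).Indep (B : Set (Fin m × Fin n))) : #B ≤ n * K₂ := by
  rw [card_eq_sum_card_fiberwise (t := univ) (f := fun v => v.2)
    (fun _ _ => mem_coe.2 (mem_univ _))]
  refine (sum_le_sum fun j _ => (partitionMatroid_indep_iff B).1 hB j).trans ?_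
  simp

theorem card_of_partitionMatroid_isBase (hK : K₂ ≤ m)
    (hB : (partitionMatroid m n K₂).IsBase (B : Set (Fin m × Fin n))) : #B = n * K₂ := by
  rw [card_eq_sum_card_fiberwise (t := univ) (f := fun v => v.2)
    (fun _ _ => mem_coe.2 (mem_univ _)),
    sum_congr rfl fun j _ => (partitionMatroid_isBase_iff hK).1 hB j]
  simp

theorem partitionMatroid_contract_isBase_iff (hK : K₂ ≤ m)
    (hS : (partitionMatroid m n K₂).Indep (S : Set (Fin m × Fin n))) :
    (partitionMatroid m n K₂ ／ (S : Set (Fin m × Fin n))).IsBase (B : Set (Fin m × Fin n)) ↔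
      (∀ j, #{v ∈ B | v.2 = j} + #{v ∈ S | v.2 = j} = K₂) ∧ Disjoint B S := by
  rw [hS.contract_isBase_iff, ← coe_union, partitionMatroid_isBase_iff hK, disjoint_coe]
  refine and_congr_left fun hBS => forall_congr' fun j => ?_
  rw [filter_union, card_union_of_disjoint (disjoint_filter_filter hBS)]

/-- A greedy base of a contraction of the partition matroid is matched with any other base of the
contraction so that exchanges are possible and no element is matched with one of larger positive
weight. -/
theorem IsGreedyBase.exists_bijOn {g : Fin m × Fin n → ℝ} (hK : K₂ ≤ m)
    (hS : (partitionMatroid m n K₂).Indep (S : Set (Fin m × Fin n)))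
    (hB : IsGreedyBase (partitionMatroid m n K₂) g S B)
    (hO : (partitionMatroid m n K₂ ／ (S : Set (Fin m × Fin n))).IsBase
      (O : Set (Fin m × Fin n))) :
    ∃ e : Fin m × Fin n → Fin m × Fin n, Set.BijOn e B O ∧
      ∀ v ∈ B, max 0 (g (e v)) ≤ max 0 (g v) ∧
        (partitionMatroid m n K₂).Indep (insert v S : Finset (Fin m × Fin n)) ∧
        (partitionMatroid m n K₂ ／ ((insert v S : Finset (Fin m × Fin n)) :
          Set (Fin m × Fin n))).IsBase (O.erase (e v) : Finset (Fin m × Fin n)) := by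
  obtain ⟨hBb, hBmax⟩ := hB
  have hBb' := (partitionMatroid_contract_isBase_iff hK hS).1 hBb
  have hO' := (partitionMatroid_contract_isBase_iff hK hS).1 hO
  obtain ⟨e, he, hcol, hfix, hout⟩ := exists_bijOn_fix_inter (fun v : Fin m × Fin n => v.2) B O
    fun j => by have := hBb'.1 j; have := hO'.1 j; omega
  refine ⟨e, he, fun v hv => ?_⟩
  have heO : e v ∈ O := he.mapsTo hv
  have hvS : v ∉ S := disjoint_left.1 hBb'.2 hv
  have hins : ∀ j, #{w ∈ insert v S | w.2 = j} = #{w ∈ S | w.2 = j} + if v.2 = j then 1 else 0 := by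
    intro j
    rw [filter_insert]
    split_ifs with h
    · rw [card_insert_of_notMem (by simp [hvS])]
    · simp
  have herase : ∀ (A : Finset (Fin m × Fin n)) (w : Fin m × Fin n), w ∈ A → ∀ j,
      #{a ∈ A.erase w | a.2 = j} + (if w.2 = j then 1 else 0) = #{a ∈ A | a.2 = j} := by
    intro A w hw j
    rw [filter_erase]
    split_ifs with h
    · exact card_erase_add_one (mem_filter.2 ⟨hw, h⟩)
    · rw [erase_eq_of_notMem (by simp [h]), add_zero]
  have hind : (partitionMatroid m n K₂).Indep (insert v S : Finset (Fin m × Fin n)) := by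
    rw [partitionMatroid_indep_iff]
    intro j
    rw [hins]
    have h1 := hBb'.1 j
    have h2 := herase B v hv j
    omega
  refine ⟨?_, hind, ?_⟩
  · by_cases hvO : v ∈ O
    · rw [hfix v hv hvO]
    · have hevB := hout v hv hvO
      have hevS : e v ∉ S := disjoint_left.1 hO'.2 heO
      have hevE : e v ∉ B.erase v := fun h => hevB (mem_of_mem_erase h)
      -- As e v lies in the column of v and outside B, swapping v for e v gives a base; maximality
      -- of B compares the two weights.
      have h := hBmax (insert (e v) (B.erase v)) (by
        rw [partitionMatroid_contract_isBase_iff hK hS]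
        constructor
        · intro j
          have h1 := herase B v hv j
          have h2 := hBb'.1 j
          have h3 := hcol v hv
          rw [filter_insert]
          split_ifs with h
          · rw [card_insert_of_notMem fun h => hevE (mem_filter.1 h).1]
            rw [← h3, if_pos h] at h1
            omega
          · rw [← h3, if_neg h] at h1
            omega
        · rw [disjoint_insert_left]
          exact ⟨hevS, hBb'.2.mono_left (erase_subset _ _)⟩)
      rw [sum_insert hevE, ← add_sum_erase B _ hv] at h
      linarith
  · rw [partitionMatroid_contract_isBase_iff hK hind]
    constructor
    · intro j
      have h1 := herase O (e v) heO j
      have h2 := hO'.1 j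
      have h3 := hins j
      rw [hcol v hv] at h1
      omega
    · rw [disjoint_insert_right]
      -- Disjointness from v is why e has to fix B ∩ O: if v is in O, the deleted element is v
      -- itself.
      refine ⟨fun h => ?_, hO'.2.mono_left (erase_subset _ _)⟩
      obtain ⟨hne, hvO⟩ := mem_erase.1 h
      exact hne (hfix v hv hvO).symm

end Matroid

/-! ### The law of the output as a recursion on the remaining picks -/

section Law

variable {V : Type*} [DecidableEq V]

/-- The law of the output of the random picks when `k` picks remain to be made after those in `l`. -/
noncomputable def completionLaw (base : List V → Finset V) : ℕ → List V → PMF (Finset V)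
  | 0, l => PMF.pure l.toFinset
  | k + 1, l =>
      if h : (base l).Nonempty then
        (PMF.uniformOfFinset (base l) h).bind fun v => completionLaw base k (v :: l)
      else completionLaw base k l

/-- `pickLaw` unfolds at the last pick, whereas the guarantee needs to condition on the next pick
from an arbitrary history. Moving one pick at a time across the bind reconciles the two. -/
theorem pickLaw_bind_completionLaw (base : List V → Finset V) (k : ℕ) :
    ∀ i, (pickLaw base i).bind (completionLaw base k) = outputLaw base (i + k) := by
  induction k with
  | zero => intro i; rfl
  | succ k ih =>
    intro i
    rw [show i + (k + 1) = (i + 1) + k by omega, ← ih (i + 1), pickLaw, PMF.bind_bind]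
    congr 1
    funext l
    rw [completionLaw]
    split_ifs with h
    · rw [PMF.bind_map]; rfl
    · rw [PMF.pure_bind]

theorem outputLaw_eq_completionLaw (base : List V → Finset V) (k : ℕ) :
    outputLaw base k = completionLaw base k [] := by
  have h := pickLaw_bind_completionLaw base k 0
  rw [zero_add, pickLaw, PMF.pure_bind] at h
  exact h.symm

theorem expect_pure {A : Type*} [Fintype A] (a : A) (f : A → ℝ) :
    expect (PMF.pure a) f = f a := by
  classical
  rw [expect, sum_eq_single a (fun b _ hb => by simp [PMF.pure_apply, hb]) (by simp)]
  simp

theorem expect_bind {A B : Type*} [Fintype A] [Fintype B] (p : PMF B) (q : B → PMF A)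
    (f : A → ℝ) : expect (p.bind q) f = expect p fun b => expect (q b) f := by
  simp only [expect, PMF.bind_apply, tsum_fintype, mul_sum]
  rw [sum_comm]
  refine sum_congr rfl fun a _ => ?_
  rw [ENNReal.toReal_sum fun b _ => ENNReal.mul_ne_top (p.apply_ne_top b) ((q b).apply_ne_top a),
    sum_mul]
  refine sum_congr rfl fun b _ => ?_
  rw [ENNReal.toReal_mul, mul_assoc]

theorem card_mul_expect_uniformOfFinset {A : Type*} [Fintype A] (s : Finset A) (hs : s.Nonempty)
    (f : A → ℝ) : (#s : ℝ) * expect (PMF.uniformOfFinset s hs) f = ∑ a ∈ s, f a := by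
  classical
  have hs' : (#s : ℝ) ≠ 0 := by exact_mod_cast hs.card_pos.ne'
  rw [expect, mul_sum, ← sum_subset (subset_univ s)
    (fun a _ ha => by simp [PMF.uniformOfFinset_apply_of_notMem hs ha])]
  refine sum_congr rfl fun a ha => ?_
  rw [PMF.uniformOfFinset_apply_of_mem hs ha, ENNReal.toReal_inv, ENNReal.toReal_natCast]
  field_simp

theorem card_mul_expect_completionLaw_succ [Fintype V] (base : List V → Finset V) (k : ℕ)
    (l : List V) (h : (base l).Nonempty) (f : Finset V → ℝ) :
    (#(base l) : ℝ) * expect (completionLaw base (k + 1) l) f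
      = ∑ v ∈ base l, expect (completionLaw base k (v :: l)) f := by
  rw [completionLaw, dif_pos h, expect_bind, card_mul_expect_uniformOfFinset]

end Law

/-! ### The guarantee -/

section Guarantee

variable {m n K₂ : ℕ} {P : Problem m n} {u U : ℝ}
  {γ : Finset (Fin m × Fin n) → Plan m n} {base : List (Fin m × Fin n) → Finset (Fin m × Fin n)}

/-- Weak submodularity of `F` on the independent sets, with submodularity ratio `u / U`. -/
theorem IsOMPGreedy.weak_submodular (hu : 0 < u) (hU : 0 < U)
    (hRSC : HasRSC (fun γ => -P.objective γ) (sparsePairs (Fin m × Fin n) (2 * (n * K₂))) u)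
    (hRSM : HasRSM (fun γ => -P.objective γ) (oneEntryPairs (Fin m × Fin n)) U)
    (hrun : IsOMPGreedy P (partitionMatroid m n K₂) γ base) {O R : Finset (Fin m × Fin n)}
    (hO : (partitionMatroid m n K₂).Indep (O : Set (Fin m × Fin n))) (hR : R ⊆ O) :
    u / U * (P.F O - P.F R) ≤ ∑ v ∈ O \ R, (P.F (insert v R) - P.F R) := by
  have hopt : ∀ S ⊆ O, P.IsOptimalPlan S (γ S) := fun S hS =>
    hrun.isOptimalPlan S (hO.subset (coe_subset.2 hS))
  have hun : R ∪ O \ R = O := union_sdiff_of_subset hR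
  have h1 := (hopt R hR).F_union_sub_le hu hU hRSM hRSC (T := O \ R) (z := γ O)
    (by rw [hun]; exact hopt O subset_rfl) sdiff_disjoint
    (by rw [hun]; have := card_le_of_partitionMatroid_indep hO; omega)
  rw [hun] at h1
  have h2 := mul_le_mul_of_nonneg_left h1 (div_pos hu hU).le
  refine h2.trans ?_
  rw [mul_sum]
  refine sum_le_sum fun v hv => ?_
  have h3 := (hopt R hR).F_insert_sub_ge hU hRSM
    (hopt (insert v R) (insert_subset (mem_sdiff.1 hv).1 hR))
  refine le_trans (le_of_eq ?_) h3
  field_simp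

/-- The gain of an average greedy pick is at least a fraction of the gain of adding any base of
the contraction. -/
theorem IsOMPGreedy.sum_gain_ge (hu : 0 < u) (hU : 0 < U)
    (hRSC : HasRSC (fun γ => -P.objective γ) (sparsePairs (Fin m × Fin n) (2 * (n * K₂))) u)
    (hRSM : HasRSM (fun γ => -P.objective γ) (oneEntryPairs (Fin m × Fin n)) U)
    (hrun : IsOMPGreedy P (partitionMatroid m n K₂) γ base) {S O B : Finset (Fin m × Fin n)}
    (hS : (partitionMatroid m n K₂).Indep (S : Set (Fin m × Fin n)))
    (hO : (partitionMatroid m n K₂ ／ (S : Set (Fin m × Fin n))).IsBase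
      (O : Set (Fin m × Fin n)))
    (hind : ∀ v ∈ B, (partitionMatroid m n K₂).Indep
      ((insert v S : Finset (Fin m × Fin n)) : Set (Fin m × Fin n)))
    {e : Fin m × Fin n → Fin m × Fin n} (he : Set.BijOn e B O)
    (hle : ∀ v ∈ B, max 0 (-partialDeriv P.objective (γ S) (e v))
      ≤ max 0 (-partialDeriv P.objective (γ S) v)) :
    u / U * (P.F O - P.F S) ≤ ∑ v ∈ B, (P.F (insert v S) - P.F S) := by
  obtain ⟨hbase, hdisj⟩ := hS.contract_isBase_iff.1 hO
  have hSO : (partitionMatroid m n K₂).Indep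
      ((S ∪ O : Finset (Fin m × Fin n)) : Set (Fin m × Fin n)) := by
    rw [union_comm, coe_union]; exact hbase.indep
  have hOind : (partitionMatroid m n K₂).Indep (O : Set (Fin m × Fin n)) :=
    hSO.subset (coe_subset.2 subset_union_right)
  have h0 := (hrun.isOptimalPlan _ hOind).F_mono (hrun.isOptimalPlan _ hSO) subset_union_right
  have h1 := (hrun.isOptimalPlan _ hS).F_union_sub_le hu hU hRSM hRSC
    (hrun.isOptimalPlan _ hSO) (disjoint_coe.1 hdisj)
    (by have := card_le_of_partitionMatroid_indep hSO; omega)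
  have h2 : ∑ v ∈ O, max 0 (-partialDeriv P.objective (γ S) v) ^ 2 / (2 * u)
      = ∑ v ∈ B, max 0 (-partialDeriv P.objective (γ S) (e v)) ^ 2 / (2 * u) :=
    (sum_nbij e (fun v hv => he.mapsTo hv) he.injOn he.surjOn fun _ _ => rfl).symm
  have h3 := mul_le_mul_of_nonneg_left
    (show P.F O - P.F S ≤ _ from (by linarith : P.F O - P.F S ≤ P.F (S ∪ O) - P.F S).trans
      (h1.trans h2.le)) (div_pos hu hU).le
  refine h3.trans ?_
  rw [mul_sum]
  refine sum_le_sum fun v hv => ?_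
  refine le_trans ?_ ((hrun.isOptimalPlan _ hS).F_insert_sub_ge hU hRSM
    (hrun.isOptimalPlan _ (hind v hv)))
  rw [show ∀ w : ℝ, u / U * (w / (2 * u)) = w / (2 * U) from fun w => by field_simp]
  exact div_le_div_of_nonneg_right (pow_le_pow_left₀ (le_max_left _ _) (hle v hv) 2) (by positivity)

/-- Lower bounds for the expected value of the output in terms of the picks made so far. -/
theorem IsOMPGreedy.expect_completionLaw_ge (hK : K₂ ≤ m) (hu : 0 < u) (hU : 0 < U)
    (hRSC : HasRSC (fun γ => -P.objective γ) (sparsePairs (Fin m × Fin n) (2 * (n * K₂))) u)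
    (hRSM : HasRSM (fun γ => -P.objective γ) (oneEntryPairs (Fin m × Fin n)) U)
    (hrun : IsOMPGreedy P (partitionMatroid m n K₂) γ base) {c : ℝ} (hc : 0 ≤ c) (k : ℕ) :
    c * k ≤ u / U → ∀ (l : List (Fin m × Fin n)) (O : Finset (Fin m × Fin n)), l.Nodup →
      (partitionMatroid m n K₂).Indep (l.toFinset : Set (Fin m × Fin n)) →
      (partitionMatroid m n K₂ ／ (l.toFinset : Set (Fin m × Fin n))).IsBase
        (O : Set (Fin m × Fin n)) → #O = k →
      P.F l.toFinset ≤ expect (completionLaw base k l) P.F ∧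
      P.F l.toFinset + c * ∑ j ∈ range k, subsetAverage P.F (j + 1) O
        ≤ (1 + c * k) * expect (completionLaw base k l) P.F := by
  induction k with
  | zero =>
    intro _ l O _ _ _ _
    simp [completionLaw, expect_pure]
  | succ k ih =>
    intro hck l O hl hS hO hcard
    have hck' : c * k ≤ u / U := by push_cast at hck; linarith
    have hgreedy := hrun.isGreedyBase l hl hS
    obtain ⟨e, he, heB⟩ := hgreedy.exists_bijOn hK hS hO
    have hcardB : #(base l) = k + 1 := by
      rw [← hcard]
      exact card_nbij e (fun v hv => he.mapsTo hv) he.injOn he.surjOn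
    have hne : (base l).Nonempty := card_pos.1 (by omega)
    have hnotMem : ∀ v ∈ base l, v ∉ l := fun v hv h =>
      disjoint_left.1 ((partitionMatroid_contract_isBase_iff hK hS).1 hgreedy.1).2 hv
        (List.mem_toFinset.2 h)
    have hstep : ∀ v ∈ base l,
        P.F (insert v l.toFinset) ≤ expect (completionLaw base k (v :: l)) P.F ∧
        P.F (insert v l.toFinset)
            + c * ∑ j ∈ range k, subsetAverage P.F (j + 1) (O.erase (e v))
          ≤ (1 + c * k) * expect (completionLaw base k (v :: l)) P.F := fun v hv => by
      have h := ih hck' (v :: l) (O.erase (e v)) (List.nodup_cons.2 ⟨hnotMem v hv, hl⟩)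
      rw [List.toFinset_cons] at h
      exact h (heB v hv).2.1 (heB v hv).2.2
        (by rw [card_erase_of_mem (he.mapsTo hv), hcard, Nat.add_sub_cancel])
    have hE := card_mul_expect_completionLaw_succ base k l hne P.F
    rw [hcardB] at hE
    set E := expect (completionLaw base (k + 1) l) P.F
    have hgain0 : ∀ v ∈ base l, 0 ≤ P.F (insert v l.toFinset) - P.F l.toFinset := fun v hv =>
      sub_nonneg.2 ((hrun.isOptimalPlan _ hS).F_mono (hrun.isOptimalPlan _ (heB v hv).2.1)
        (subset_insert _ _))
    have hgain := hrun.sum_gain_ge hu hU hRSC hRSM hS hO (fun v hv => (heB v hv).2.1) he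
      fun v hv => (heB v hv).1
    have hgain_nonneg := sum_nonneg hgain0
    rw [sum_sub_distrib, sum_const, hcardB, nsmul_eq_mul] at hgain hgain_nonneg
    have hsum1 := sum_le_sum fun v hv => (hstep v hv).1
    have hsum2 := sum_le_sum fun v hv => (hstep v hv).2
    rw [← hE] at hsum1
    rw [← mul_sum, ← hE, sum_add_distrib, ← mul_sum, sum_comm] at hsum2
    -- Since e is a bijection onto O, summing over the picks v amounts to summing over the deleted
    -- elements of O.
    have havg : ∀ j ∈ range k, ∑ v ∈ base l, subsetAverage P.F (j + 1) (O.erase (e v))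
        = (k + 1) * subsetAverage P.F (j + 1) O := fun j hj => by
      rw [sum_nbij (s := base l) (t := O) e (fun v hv => he.mapsTo hv) he.injOn he.surjOn
        (g := fun w => subsetAverage P.F (j + 1) (O.erase w)) fun _ _ => rfl]
      exact sum_subsetAverage_erase P.F hcard (mem_range.1 hj)
    rw [sum_congr rfl havg, ← mul_sum] at hsum2
    -- The top average, which the induction hypothesis for k-element sets does not supply.
    have hFO : subsetAverage P.F (k + 1) O = P.F O := by
      rw [← hcard, subsetAverage_card]
    rw [sum_range_succ, hFO]
    push_cast at hsum1 hsum2 hgain hgain_nonneg hck ⊢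
    have hk : (0 : ℝ) < k + 1 := by positivity
    have hSE : P.F l.toFinset ≤ E := le_of_mul_le_mul_left (by linarith) hk
    refine ⟨hSE, ?_⟩
    -- The gain of this pick pays for the top average. If F(O) exceeds F(S), use E ≥ F(S), c (k + 1)
    -- ≤ u / U and the greedy gain; otherwise the left side is nonpositive and the gains are
    -- nonnegative.
    have hpick : c * (k + 1) * (P.F O - E)
        ≤ ∑ v ∈ base l, P.F (insert v l.toFinset) - (k + 1) * P.F l.toFinset := by
      rcases le_total (P.F l.toFinset) (P.F O) with h | h
      · have h1 : c * (k + 1) * (P.F O - E) ≤ c * (k + 1) * (P.F O - P.F l.toFinset) :=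
          mul_le_mul_of_nonneg_left (by linarith) (by positivity)
        have h2 := mul_le_mul_of_nonneg_right hck (sub_nonneg.2 h)
        linarith
      · have h1 : c * (k + 1) * (P.F O - E) ≤ 0 :=
          mul_nonpos_of_nonneg_of_nonpos (by positivity) (by linarith)
        linarith
    refine le_of_mul_le_mul_left ?_ hk
    linarith

/-- The expected value of the output of the greedy algorithm is within a factor
`(1 + U / u) ^ (-2)` of the value of any independent set. -/
theorem IsOMPGreedy.expect_outputLaw_ge (hK₂ : K₂ ≤ m) (hu : 0 < u)
    (hRSC : HasRSC (fun γ => -P.objective γ) (sparsePairs (Fin m × Fin n) (2 * (n * K₂))) u)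
    (hRSM : HasRSM (fun γ => -P.objective γ) (oneEntryPairs (Fin m × Fin n)) U)
    (hrun : IsOMPGreedy P (partitionMatroid m n K₂) γ base) {S : Finset (Fin m × Fin n)}
    (hS : (partitionMatroid m n K₂).Indep (S : Set (Fin m × Fin n))) :
    P.F S * (1 + U / u) ^ (-2 : ℤ) ≤ expect (outputLaw base (n * K₂)) P.F := by
  have hexp := outputLaw_eq_completionLaw base (n * K₂)
  obtain ⟨B, hB, hSB⟩ := hS.exists_isBase_superset
  lift B to Finset (Fin m × Fin n) using Set.toFinite B
  rw [coe_subset] at hSB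
  have hcard := card_of_partitionMatroid_isBase hK₂ hB
  have hempty : (partitionMatroid m n K₂).Indep ((∅ : Finset (Fin m × Fin n)) : Set _) :=
    hS.subset (by simp)
  have hF0 := (hrun.isOptimalPlan ∅ hempty).F_empty
  have hFB := (hrun.isOptimalPlan _ hS).F_mono (hrun.isOptimalPlan _ hB.indep) hSB
  have hFB0 := (hrun.isOptimalPlan _ hempty).F_mono (hrun.isOptimalPlan _ hB.indep)
    (empty_subset _)
  rw [hF0] at hFB0
  -- With K = 0 there may be no entry from which to derive U > 0, but then both sides are F(∅) = 0.
  rcases Nat.eq_zero_or_pos (n * K₂) with hK | hK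
  · have hS0 : S = ∅ := subset_empty.1 (hSB.trans (card_eq_zero.1 (hcard.trans hK)).subset)
    rw [hexp, hK, completionLaw, expect_pure, hS0, List.toFinset_nil, hF0, zero_mul]
  · obtain ⟨v, -⟩ := card_pos.1 (hcard.symm ▸ hK : 0 < #B)
    have hU : 0 < U := hu.trans_le (hRSC.le_smoothness (by omega) hRSM v)
    have hK' : (0 : ℝ) < (n * K₂ : ℕ) := by exact_mod_cast hK
    set K := n * K₂
    set a := u / U with ha
    have ha0 : 0 < a := div_pos hu hU
    have hck : a / K * K = a := div_mul_cancel₀ a hK'.ne'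
    -- The weight c = a / K is the largest with c K ≤ a, as the induction requires.
    have hmain := (hrun.expect_completionLaw_ge hK₂ hu hU hRSC hRSM (c := a / K) (by positivity) K
      hck.le [] B List.nodup_nil (by simp) (by simpa using hB) hcard).2
    rw [← hexp, hck, List.toFinset_nil, hF0, zero_add] at hmain
    have hAK : subsetAverage P.F K B = P.F B := by rw [← hcard, subsetAverage_card]
    have havg := sum_range_ge_of_increments (A := fun j => subsetAverage P.F j B) (K := K) ha0.le
      ((subsetAverage_zero _ _).trans hF0) (by rw [hAK]; exact hFB0) fun j hj => by
        have h := subsetAverage_succ_sub_ge P.F (a := a) (j := j) (O := B) (by omega)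
          fun R hR => hrun.weak_submodular hu hU hRSC hRSM hB.indep hR
        rw [hcard] at h
        rwa [hAK]
    simp only [hAK] at havg
    set E := expect (outputLaw base K) P.F
    set A := ∑ j ∈ range K, subsetAverage P.F (j + 1) B
    have h1 : a * P.F B ≤ (1 + a) * (A / K) := by
      rw [← mul_div_assoc, le_div_iff₀ hK']
      linarith
    have h2 : a * (A / K) ≤ (1 + a) * E := by
      rwa [← mul_div_assoc, ← div_mul_eq_mul_div]
    have h3 : a ^ 2 * P.F B ≤ (1 + a) ^ 2 * E := by
      have h4 := mul_le_mul_of_nonneg_left h1 ha0.le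
      have h5 := mul_le_mul_of_nonneg_left h2 (by positivity : 0 ≤ 1 + a)
      linarith
    -- Since a = u / U, 1 + U / u = (1 + a) / a.
    have hfac : (1 + U / u) ^ (-2 : ℤ) = a ^ 2 / (1 + a) ^ 2 := by
      rw [zpow_neg, ← div_pow, ha, ← inv_zpow]
      norm_cast
      congr 1
      field_simp
      ring
    rw [hfac]
    calc P.F S * (a ^ 2 / (1 + a) ^ 2) ≤ P.F B * (a ^ 2 / (1 + a) ^ 2) :=
          mul_le_mul_of_nonneg_right hFB (by positivity)
      _ = a ^ 2 * P.F B / (1 + a) ^ 2 := by ring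
      _ ≤ E := by
        rw [div_le_iff₀ (by positivity)]
        linarith

end Guarantee

end SparseUOT

theorem lemma3 {m n : ℕ} (P : SparseUOT.Problem m n) (hP : P.IsValid)
    (K₂ : ℕ) (hK₂ : K₂ ≤ m)
    -- restricted strong concavity and smoothness parameters of the negated objective
    (u U : ℝ) (hu : 0 < u)
    (hRSC : SparseUOT.HasRSC (fun γ => -P.objective γ)
      (SparseUOT.sparsePairs (Fin m × Fin n) (2 * (n * K₂))) u)
    (hRSM : SparseUOT.HasRSM (fun γ => -P.objective γ)
      (SparseUOT.oneEntryPairs (Fin m × Fin n)) U)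
    -- a run of the algorithm
    (γ : Finset (Fin m × Fin n) → SparseUOT.Plan m n)
    (base : List (Fin m × Fin n) → Finset (Fin m × Fin n))
    (hrun : SparseUOT.IsOMPGreedy P (SparseUOT.partitionMatroid m n K₂) γ base)
    -- an optimal solution of the column-sparse problem
    (Sopt : Finset (Fin m × Fin n))
    (hSopt : (SparseUOT.partitionMatroid m n K₂).Indep ↑Sopt)
    (hmax : ∀ S : Finset (Fin m × Fin n),
      (SparseUOT.partitionMatroid m n K₂).Indep ↑S → P.F S ≤ P.F Sopt) :
    P.F Sopt * (1 + U / u) ^ (-2 : ℤ) ≤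
      SparseUOT.expect (SparseUOT.outputLaw base (n * K₂)) P.F :=
  hrun.expect_outputLaw_ge hK₂ hu hRSC hRSM hSopt
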